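/- **Conventions.** A structured matrix $\bar M\in\{0,*\}^{k\times l}$ has entries that are either fixed zeros or free real parameters $*$, all independent; a realization is a real matrix obtained by assigning values to the $n_{\bar M}$ entries $*$, so realizations correspond to points of $\mathbb R^{n_{\bar M}}$. A proper variety in $\mathbb R^d$ is the solution set of a system of polynomial equations that is not all of $\mathbb R^d$. The generic rank $\operatorname{grank}\bar M$ is the maximum rank of the realizations of $\bar M$; $[\bar M_1;\bar M_2;\dots]$ denotes vertical stacking. Let $\bar A\in\{0,*\}^{n\times n}$, $\bar C\in\{0,*\}^{p\times n}$, $\bar F\in\{0,*\}^{r\times n}$. * $\bar A$ is *generically diagonalizable* if there is a proper variety $\mathbb V\subseteq\mathbb R^{n_{\bar A}}$ such that every realization $A\notin\mathbb V$ is diagonalizable (over $\mathbb C$). * A real triple $(A,C,F)$ is *functionally observable* if, for the system $\dot x=Ax+Bu$, $y=Cx$ (with any input matrix $B$), for every initial state $x(0)$ and input $u$ there is a finite time $T$ such that $Fx(0)$ is uniquely determined by $y(t)$ and $u(t)$, $0\le t\le T$. The triple $(\bar A,\bar C,\bar F)$ is *structurally functionally observable* (SFO) if there is a proper variety $\mathbb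 V\subseteq\mathbb R^{n_{\bar A}}\times\mathbb R^{n_{\bar C}}\times\mathbb R^{n_{\bar F}}$ such that all realizations $(A,C,F)\notin\mathbb V$ are functionally observable. * $\mathcal G(\bar A,\bar C)$ is the digraph with state vertices $X=\{x_1,\dots,x_n\}$, output vertices $y_1,\dots,y_p$, an edge $(x_i,x_j)$ whenever $\bar A_{ji}\neq0$, and an edge $(x_i,y_j)$ whenever $\bar C_{ji}\ne0$. A state vertex is *output-reachable* if there is a path from it to some output vertex. A *dilation* is a set $X_s\subseteq X$ having fewer than $|X_s|$ out-neighbours in $\mathcal G(\bar A,\bar C)$; a *minimal dilation* is a dilation none of whose proper subsets is a dilation. * $X_F=\{x_i:\bar F(:,i)\neq0\}$ is the set of *functional states*, and $\bar e_i\in\{0,*\}^{1\times n}$ is the structured row whose $i$-th entry is $*$ and whose other entries are $0$. **Theorem.** Suppose $\bar A$ is generically diagonalizable. Then the following statements are equivalent: (a) $(\bar A,\bar C,\bar F)$ is structurally functionally observable. (b) Every $x\in X_F$ is output-reachable, and $\operatorname{grank}[\bar A;\bar C]=\operatorname{grank}[\bar A;\bar C;\bar F]$. (c) Every $x\in X_F$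 is output-reachable, and $\operatorname{grank}[\bar A;\bar C]=\operatorname{grank}[\bar A;\bar C;\bar e_i]$ for each $x_i\in X_F$. (d) Every $x\in X_F$ is output-reachable, and no $x\in X_F$ is contained in a minimal dilation of $\mathcal G(\bar A,\bar C)$. -/

import Mathlib

open MeasureTheory

noncomputable section

namespace StructSys

/-! ### Structured matrices, realizations, proper varieties, generic rank -/

/-- A structured matrix: `true` is a free parameter `*`, `false` is a fixed zero. -/
abbrev SMatrix (ι κ : Type) : Type := Matrix ι κ Bool

/-- The positions of the free parameters of `M`. Its cardinality is `n_M`, and `Stars M → ℝ`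
is the parameter space `ℝ^{n_M}`. -/
abbrev Stars {ι κ : Type} (M : SMatrix ι κ) : Type :=
  {ij : ι × κ // M ij.1 ij.2 = true}

/-- The realization of `M` with parameter values `θ`. -/
def realize {ι κ : Type} (M : SMatrix ι κ) (θ : Stars M → ℝ) : Matrix ι κ ℝ :=
  fun i j => if h : M i j = true then θ ⟨(i, j), h⟩ else 0

/-- An algebraic variety in `ℝ^σ` other than the whole space. -/
def IsProperVariety {σ : Type} (V : Set (σ → ℝ)) : Prop :=
  (∃ P : Set (MvPolynomial σ ℝ), V = {x | ∀ f ∈ P, MvPolynomial.eval x f = 0}) ∧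
    V ≠ Set.univ

/-- The generic rank: the maximum rank of the realizations of `M`. -/
def grank {ι κ : Type} [Fintype κ] (M : SMatrix ι κ) : ℕ :=
  sSup (Set.range fun θ : Stars M → ℝ => (realize M θ).rank)

/-- The supremum in `grank` is an attained maximum. -/
theorem isGreatest_grank {ι κ : Type} [Fintype κ] (M : SMatrix ι κ) :
    IsGreatest (Set.range fun θ : Stars M → ℝ => (realize M θ).rank) (grank M) := by
  have hb : BddAbove (Set.range fun θ : Stars M → ℝ => (realize M θ).rank) := by
    refine ⟨Fintype.card κ, ?_⟩
    rintro _ ⟨θ, rfl⟩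
    exact Matrix.rank_le_card_width _
  exact ⟨Nat.sSup_mem ⟨_, 0, rfl⟩ hb, fun _ h => le_csSup hb h⟩

/-- `[M; N]`, the matrix `M` stacked on top of `N`. -/
abbrev stack {ι₁ ι₂ κ : Type} (M : SMatrix ι₁ κ) (N : SMatrix ι₂ κ) : SMatrix (ι₁ ⊕ ι₂) κ :=
  Matrix.fromRows M N

/-- The structured row whose `i`-th entry is `*` and whose other entries are zero. -/
def unitRow {n : ℕ} (i : Fin n) : SMatrix (Fin 1) (Fin n) :=
  fun _ j => decide (j = i)

/-! ### Generic diagonalizability -/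

/-- A real square matrix is diagonalizable (over `ℂ`). -/
def IsDiagonalizable {n : ℕ} (A : Matrix (Fin n) (Fin n) ℝ) : Prop :=
  ∃ (P : Matrix (Fin n) (Fin n) ℂ) (d : Fin n → ℂ),
    IsUnit P ∧ A.map Complex.ofReal * P = P * Matrix.diagonal d

/-- Almost all realizations are diagonalizable. -/
def GenericallyDiagonalizable {n : ℕ} (A : SMatrix (Fin n) (Fin n)) : Prop :=
  ∃ V : Set (Stars A → ℝ), IsProperVariety V ∧
    ∀ θ : Stars A → ℝ, θ ∉ V → IsDiagonalizable (realize A θ)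

/-! ### Functional observability -/

/-- Admissible inputs on `[0, ∞)`: locally integrable ones. -/
def IsInput {m : ℕ} (u : ℝ → Fin m → ℝ) : Prop :=
  ∀ t : ℝ, 0 ≤ t → IntervalIntegrable u volume 0 t

/-- `x` is the state trajectory on `[0, ∞)` of `ẋ(t) = A x(t) + B u(t)`, `x(0) = x₀`
(in integrated form, since `u` need not be continuous). -/
def IsTrajectory {n m : ℕ} (A : Matrix (Fin n) (Fin n) ℝ) (B : Matrix (Fin n) (Fin m) ℝ)
    (u : ℝ → Fin m → ℝ) (x₀ : Fin n → ℝ) (x : ℝ → Fin n → ℝ) : Prop :=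
  ContinuousOn x (Set.Ici 0) ∧
    ∀ t : ℝ, 0 ≤ t → x t = x₀ + ∫ s in (0 : ℝ)..t, (A.mulVec (x s) + B.mulVec (u s))

/-- The system `ẋ = A x + B u`, `y = C x`, `z = F x` is functionally observable: for any initial
state `x₀` and input `u` there is a finite time `T` such that every initial state which is
compatible with the input and the output on `[0, T]` has the same value of `F x(0)`. -/
def SystemFunctionallyObservable {n m p r : ℕ} (A : Matrix (Fin n) (Fin n) ℝ)
    (B : Matrix (Fin n) (Fin m) ℝ) (C : Matrix (Fin p) (Fin n) ℝ)
    (F : Matrix (Fin r) (Fin n) ℝ) : Prop :=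
  ∀ (x₀ : Fin n → ℝ) (u : ℝ → Fin m → ℝ), IsInput u →
    ∃ T : ℝ, 0 < T ∧
      ∀ (x₁ : Fin n → ℝ) (x x' : ℝ → Fin n → ℝ),
        IsTrajectory A B u x₀ x → IsTrajectory A B u x₁ x' →
        (∀ t ∈ Set.Icc 0 T, C.mulVec (x t) = C.mulVec (x' t)) →
        F.mulVec x₀ = F.mulVec x₁

/-- The triple `(A, C, F)` is functionally observable (whatever the input matrix `B` is). -/
def FunctionallyObservable {n p r : ℕ} (A : Matrix (Fin n) (Fin n) ℝ)
    (C : Matrix (Fin p) (Fin n) ℝ) (F : Matrix (Fin r) (Fin n) ℝ) : Prop :=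
  ∀ (m : ℕ) (B : Matrix (Fin n) (Fin m) ℝ), SystemFunctionallyObservable A B C F

/-- Structural functional observability: almost all realizations of `(A, C, F)`, with respect to
the joint parameter space, are functionally observable. -/
def SFO {n p r : ℕ} (A : SMatrix (Fin n) (Fin n)) (C : SMatrix (Fin p) (Fin n))
    (F : SMatrix (Fin r) (Fin n)) : Prop :=
  ∃ V : Set (Stars A ⊕ Stars C ⊕ Stars F → ℝ), IsProperVariety V ∧
    ∀ θ : Stars A ⊕ Stars C ⊕ Stars F → ℝ, θ ∉ V →
      FunctionallyObservable
        (realize A fun s => θ (Sum.inl s))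
        (realize C fun s => θ (Sum.inr (Sum.inl s)))
        (realize F fun s => θ (Sum.inr (Sum.inr s)))

/-! ### The digraph of `(A, C)`, output-reachability, dilations -/

/-- The digraph `𝒢(A, C)` on the state vertices `Sum.inl i` and the output vertices `Sum.inr k`. -/
def systemDigraph {n p : ℕ} (A : SMatrix (Fin n) (Fin n)) (C : SMatrix (Fin p) (Fin n)) :
    Digraph (Fin n ⊕ Fin p) where
  Adj
    | Sum.inl i, Sum.inl j => A j i = true
    | Sum.inl i, Sum.inr k => C k i = true
    | Sum.inr _, _ => False

/-- There is a path from the state vertex `x_i` to some output vertex. -/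
def OutputReachable {n p : ℕ} (A : SMatrix (Fin n) (Fin n)) (C : SMatrix (Fin p) (Fin n))
    (i : Fin n) : Prop :=
  ∃ k : Fin p, Relation.ReflTransGen (systemDigraph A C).Adj (Sum.inl i) (Sum.inr k)

/-- The set of (indices of) functional states: nonzero columns of `F`. -/
def functionalStates {n r : ℕ} (F : SMatrix (Fin r) (Fin n)) : Set (Fin n) :=
  {i | ∃ k : Fin r, F k i = true}

/-- The set of out-neighbours of a set of state vertices. -/
def outNeighbors {n p : ℕ} (A : SMatrix (Fin n) (Fin n)) (C : SMatrix (Fin p) (Fin n))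
    (S : Set (Fin n)) : Set (Fin n ⊕ Fin p) :=
  {v | ∃ i ∈ S, (systemDigraph A C).Adj (Sum.inl i) v}

/-- A dilation: a set of state vertices with fewer out-neighbours than elements. -/
def IsDilation {n p : ℕ} (A : SMatrix (Fin n) (Fin n)) (C : SMatrix (Fin p) (Fin n))
    (S : Set (Fin n)) : Prop :=
  (outNeighbors A C S).ncard < S.ncard

/-- A dilation none of whose proper subsets is a dilation. -/
def IsMinimalDilation {n p : ℕ} (A : SMatrix (Fin n) (Fin n)) (C : SMatrix (Fin p) (Fin n))
    (S : Set (Fin n)) : Prop :=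
  IsDilation A C S ∧ ∀ S' : Set (Fin n), S' ⊂ S → ¬ IsDilation A C S'

end StructSys

end

/-!
Functional observability of `(A, C, F)` means that `F` annihilates the unobservable subspace
`⋂ ker (C A ^ k)`. For almost all entries of `F` this says that the vectors of that subspace vanish
at the functional states. A unit vector at a state which is not output-reachable is unobservable,
and so is every vector of `ker [A; C]`. For almost all parameters, the vectors of this kernel vanish
at `i` exactly if column `i` is a coloop of `[A; C]`, which is the rank condition and, by Hall's
theorem, the dilation condition.

Conversely, if `A` is diagonalizable, the unobservable subspace is spanned over `ℂ` by the
eigenvectors of `A` in `ker C`. Those with eigenvalue `0` are controlled by the coloops. Those with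
eigenvalue `μ ≠ 0` make `1 - t A` singular at `t = μ⁻¹`, and keep it singular when a row is replaced
by a row of `C`. On the output-reachable states, every row of `A` can be replaced in such a way that
the determinant, a polynomial in `t` and the parameters, is nonzero; it does not involve the
parameters in that row. So a common divisor of all these determinants involves `t` only; it divides
`det (1 - t A)`, which is `1` when all parameters are zero, so it is constant. By Gauss's lemma the
determinants then generate an ideal containing a nonzero polynomial in the parameters alone, and
outside its zero set there is no such eigenvector.
-/

noncomputable section

namespace StructSys

open Filter MvPolynomial
open scoped Matrix

/-! ### Zariski-generic parameters -/

section Generic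

variable {σ τ R : Type*} [CommRing R] [IsDomain R]

/-- The filter of Zariski-generic points of `R^σ`: a set is large if it contains the complement of
a hypersurface. Thus `∀ᶠ θ in generic σ R, Q θ` says that `Q` holds for almost all parameters. -/
def generic (σ R : Type*) [CommRing R] [IsDomain R] : Filter (σ → R) where
  sets := {s | ∃ f : MvPolynomial σ R, f ≠ 0 ∧ ∀ θ, eval θ f ≠ 0 → θ ∈ s}
  univ_sets := ⟨1, one_ne_zero, fun _ _ => trivial⟩
  sets_of_superset := fun ⟨f, hf, hs⟩ hst => ⟨f, hf, fun θ hθ => hst (hs θ hθ)⟩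
  inter_sets := by
    rintro s t ⟨f, hf, hs⟩ ⟨g, hg, ht⟩
    refine ⟨f * g, mul_ne_zero hf hg, fun θ hθ => ?_⟩
    rw [map_mul] at hθ
    exact ⟨hs θ (left_ne_zero_of_mul hθ), ht θ (right_ne_zero_of_mul hθ)⟩

theorem eventually_eval_ne_zero {f : MvPolynomial σ R} (hf : f ≠ 0) :
    ∀ᶠ θ in generic σ R, eval θ f ≠ 0 :=
  ⟨f, hf, fun _ => id⟩

theorem eventually_eval_ne_zero_of_eval_ne_zero {f : MvPolynomial σ R} {θ₀ : σ → R}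
    (h : eval θ₀ f ≠ 0) : ∀ᶠ θ in generic σ R, eval θ f ≠ 0 :=
  eventually_eval_ne_zero fun hf => h (by rw [hf, map_zero])

instance neBot_generic [Infinite R] : (generic σ R).NeBot := by
  refine ⟨fun h => ?_⟩
  obtain ⟨f, hf, hθ⟩ : ∀ᶠ _ in generic σ R, False := by rw [h]; exact eventually_bot
  exact hf (MvPolynomial.funext fun θ => by simpa only [map_zero] using not_not.mp (hθ θ))

theorem tendsto_comp_generic {e : σ → τ} (he : Function.Injective e) :
    Tendsto (fun θ : τ → R => θ ∘ e) (generic τ R) (generic σ R) := by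
  rintro s ⟨f, hf, hs⟩
  refine ⟨rename e f, (map_ne_zero_iff _ (rename_injective e he)).mpr hf, fun θ hθ => ?_⟩
  rw [eval_rename] at hθ
  exact hs _ hθ

theorem eventually_generic_comp_equiv_iff (e : σ ≃ τ) {Q : (σ → R) → Prop} :
    (∀ᶠ θ in generic τ R, Q (θ ∘ e)) ↔ ∀ᶠ θ in generic σ R, Q θ := by
  refine ⟨fun h => ?_, (tendsto_comp_generic e.injective).eventually⟩
  simpa only [Function.comp_assoc, Equiv.symm_comp_self, Function.comp_id] using
    (tendsto_comp_generic (R := R) e.symm.injective).eventually h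

theorem eventually_eventually_of_eventually_generic_sum {Q : (σ ⊕ τ → R) → Prop}
    (h : ∀ᶠ θ in generic (σ ⊕ τ) R, Q θ) :
    ∀ᶠ α in generic σ R, ∀ᶠ β in generic τ R, Q (Sum.elim α β) := by
  obtain ⟨f, hf, hQ⟩ := h
  -- `e f` is `f` read as a polynomial in `β` whose coefficients are polynomials in `α`.
  let e := (renameEquiv R (Equiv.sumComm σ τ)).trans (sumAlgEquiv R τ σ)
  have eval_e (α : σ → R) (β : τ → R) : eval β (map (eval α) (e f)) = eval (Sum.elim α β) f := by
    suffices h : ((eval β).comp (map (eval α))).comp (e : _ →+* _) = eval (Sum.elim α β) from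
      DFunLike.congr_fun h f
    refine ringHom_ext (fun r => by simp [e]) ?_
    rintro (s | s) <;> simp [e]
  obtain ⟨m, hm⟩ : ∃ m, coeff m (e f) ≠ 0 :=
    ne_zero_iff.mp ((map_ne_zero_iff _ e.injective).mpr hf)
  filter_upwards [eventually_eval_ne_zero hm] with α hα
  have map_ne_zero : map (eval α) (e f) ≠ 0 := fun h0 => hα (by rw [← coeff_map, h0, coeff_zero])
  filter_upwards [eventually_eval_ne_zero map_ne_zero] with β hβ
  exact hQ _ (eval_e α β ▸ hβ)

end Generic

theorem exists_isProperVariety_iff {σ : Type} {Q : (σ → ℝ) → Prop} :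
    (∃ V, IsProperVariety V ∧ ∀ θ, θ ∉ V → Q θ) ↔ ∀ᶠ θ in generic σ ℝ, Q θ := by
  constructor
  · rintro ⟨V, ⟨⟨P, rfl⟩, hV⟩, hQ⟩
    obtain ⟨θ₀, hθ₀⟩ := (Set.ne_univ_iff_exists_notMem _).mp hV
    simp only [Set.mem_ofPred_eq, not_forall] at hθ₀
    obtain ⟨f, hfP, hf⟩ := hθ₀
    filter_upwards [eventually_eval_ne_zero_of_eval_ne_zero hf] with θ hθ
    exact hQ θ fun h => hθ (h f hfP)
  · rintro ⟨f, hf, hQ⟩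
    refine ⟨{θ | ∀ g ∈ ({f} : Set _), eval θ g = 0}, ⟨⟨{f}, rfl⟩, ?_⟩, fun θ hθ => hQ θ ?_⟩
    · obtain ⟨θ, hθ⟩ := (eventually_eval_ne_zero hf).exists
      exact fun h => hθ (h.ge (Set.mem_univ θ) f rfl)
    · simpa using hθ

section Realizations

variable {ι ι₁ ι₂ κ : Type} {R S : Type*}

/-- The realization of `M` with parameter values in an arbitrary ring. Over `ℝ` this is `realize`;
over a polynomial ring with its variables as parameters it is the generic realization. -/
def realizeOver [Zero R] (M : SMatrix ι κ) (x : Stars M → R) : Matrix ι κ R :=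
  fun i j => if h : M i j = true then x ⟨(i, j), h⟩ else 0

theorem map_realizeOver [Semiring R] [Semiring S] (f : R →+* S) (M : SMatrix ι κ)
    (x : Stars M → R) :
    (realizeOver M x).map f = realizeOver M (f ∘ x) := by
  ext i j
  by_cases h : M i j = true <;> simp [realizeOver, h]

theorem map_eval_realizeOver_X (M : SMatrix ι κ) (θ : Stars M → ℝ) :
    (realizeOver M (X : Stars M → MvPolynomial (Stars M) ℝ)).map (eval θ) = realize M θ := by
  rw [map_realizeOver]
  exact congrArg (realizeOver M) (funext fun _ => eval_X _)

theorem exists_realizeOver_eq [Zero R] {M : SMatrix ι κ} {B : Matrix ι κ R}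
    (hB : ∀ i j, ¬ M i j = true → B i j = 0) : ∃ θ : Stars M → R, realizeOver M θ = B := by
  refine ⟨fun s => B s.1.1 s.1.2, Matrix.ext fun i j => ?_⟩
  by_cases h : M i j = true <;> simp [realizeOver, h, hB]

/-- The parameters of `[M; N]` are those of `M` together with those of `N`. -/
def starsStackEquiv (M : SMatrix ι₁ κ) (N : SMatrix ι₂ κ) :
    Stars (stack M N) ≃ Stars M ⊕ Stars N where
  toFun
    | ⟨(Sum.inl i, j), h⟩ => Sum.inl ⟨(i, j), h⟩
    | ⟨(Sum.inr i, j), h⟩ => Sum.inr ⟨(i, j), h⟩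
  invFun
    | Sum.inl ⟨(i, j), h⟩ => ⟨(Sum.inl i, j), h⟩
    | Sum.inr ⟨(i, j), h⟩ => ⟨(Sum.inr i, j), h⟩
  left_inv := by rintro ⟨⟨_ | _, _⟩, _⟩ <;> rfl
  right_inv := by rintro (⟨⟨_, _⟩, _⟩ | ⟨⟨_, _⟩, _⟩) <;> rfl

theorem realize_stack_comp (M : SMatrix ι₁ κ) (N : SMatrix ι₂ κ) (θ : Stars M ⊕ Stars N → ℝ) :
    realize (stack M N) (θ ∘ starsStackEquiv M N) =
      Matrix.fromRows (realize M (θ ∘ Sum.inl)) (realize N (θ ∘ Sum.inr)) := by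
  ext (_ | _) _ <;> rfl

theorem eventually_realize_stack_iff {M : SMatrix ι₁ κ} {N : SMatrix ι₂ κ}
    {Q : Matrix (ι₁ ⊕ ι₂) κ ℝ → Prop} :
    (∀ᶠ θ in generic (Stars (stack M N)) ℝ, Q (realize (stack M N) θ)) ↔
      ∀ᶠ θ in generic (Stars M ⊕ Stars N) ℝ,
        Q (Matrix.fromRows (realize M (θ ∘ Sum.inl)) (realize N (θ ∘ Sum.inr))) := by
  simp_rw [← realize_stack_comp]
  exact (eventually_generic_comp_equiv_iff (starsStackEquiv M N)).symm

end Realizations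

/-! ### Generic rank -/

section GenericRank

variable {m n σ K : Type*} [Field K]

theorem linearIndependent_col_iff_exists_mul_eq_one [Fintype m] [Finite n]
    [DecidableEq n] {M : Matrix m n K} :
    LinearIndependent K M.col ↔ ∃ L : Matrix n m K, L * M = 1 := by
  classical
  cases nonempty_fintype n
  rw [← Matrix.mulVec_injective_iff]
  refine ⟨fun h => ?_, fun ⟨L, hL⟩ => ?_⟩
  · obtain ⟨g, hg⟩ := M.mulVecLin.exists_leftInverse_of_injective (LinearMap.ker_eq_bot.mpr h)
    refine ⟨LinearMap.toMatrix' g, Matrix.toLin'.injective ?_⟩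
    rw [Matrix.toLin'_mul, Matrix.toLin'_toMatrix', Matrix.toLin'_one]
    exact hg
  · exact Function.LeftInverse.injective (g := L.mulVec) fun v => by
      rw [Matrix.mulVec_mulVec, hL, Matrix.one_mulVec]

theorem eventually_linearIndependent_col [Finite m] [Finite n]
    {P : Matrix m n (MvPolynomial σ K)} {θ₀ : σ → K}
    (h : LinearIndependent K (P.map (eval θ₀)).col) :
    ∀ᶠ θ in generic σ K, LinearIndependent K (P.map (eval θ)).col := by
  classical
  cases nonempty_fintype m
  cases nonempty_fintype n
  obtain ⟨L, hL⟩ := linearIndependent_col_iff_exists_mul_eq_one.mp h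
  let D := (L.map C : Matrix n m (MvPolynomial σ K)) * P
  have eval_det (θ : σ → K) : eval θ D.det = (L * P.map (eval θ)).det := by
    have map_L : (L.map C).map (eval θ) = L := by ext; exact eval_C _
    rw [RingHom.map_det, RingHom.mapMatrix_apply, Matrix.map_mul, map_L]
  have hdet : eval θ₀ D.det ≠ 0 := by
    rw [eval_det, hL, Matrix.det_one]
    exact one_ne_zero
  filter_upwards [eventually_eval_ne_zero_of_eval_ne_zero hdet] with θ hθ
  rw [eval_det] at hθ
  refine linearIndependent_col_iff_exists_mul_eq_one.mpr ⟨(L * P.map (eval θ))⁻¹ * L, ?_⟩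
  rw [Matrix.mul_assoc, Matrix.nonsing_inv_mul _ hθ.isUnit]

theorem eventually_linearIndepOn_col [Finite m] [Finite n]
    {P : Matrix m n (MvPolynomial σ K)} {θ₀ : σ → K} {T : Set n}
    (h : LinearIndepOn K (P.map (eval θ₀)).col T) :
    ∀ᶠ θ in generic σ K, LinearIndepOn K (P.map (eval θ)).col T :=
  eventually_linearIndependent_col (P := P.submatrix id ((↑) : T → n)) h

theorem eventually_rank_le [Finite m] [Fintype n] (P : Matrix m n (MvPolynomial σ K))
    (θ₀ : σ → K) :
    ∀ᶠ θ in generic σ K, (P.map (eval θ₀)).rank ≤ (P.map (eval θ)).rank := by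
  classical
  have finrank_span_image {M : Matrix m n K} {T : Set n} (hT : LinearIndepOn K M.col T) :
      Module.finrank K (Submodule.span K (M.col '' T)) = Fintype.card T := by
    rw [Set.image_eq_range]
    exact finrank_span_eq_card hT
  obtain ⟨T, -, -, hspan, hT⟩ := exists_linearIndepOn_extension
    (linearIndepOn_empty K (P.map (eval θ₀)).col) (Set.empty_subset Set.univ)
  filter_upwards [eventually_linearIndepOn_col hT] with θ hθ
  rw [Matrix.rank_eq_finrank_span_cols, Matrix.rank_eq_finrank_span_cols, ← Set.image_univ]
  calc _ ≤ Module.finrank K (Submodule.span K ((P.map (eval θ₀)).col '' T)) :=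
        Submodule.finrank_mono (Submodule.span_le.mpr hspan)
    _ = Module.finrank K (Submodule.span K ((P.map (eval θ)).col '' T)) := by
        rw [finrank_span_image hT, finrank_span_image hθ]
    _ ≤ _ := Submodule.finrank_mono (Submodule.span_mono (Set.image_subset_range _ _))

end GenericRank

theorem eventually_rank_realize_eq_grank {ι κ : Type} [Finite ι] [Fintype κ] (M : SMatrix ι κ) :
    ∀ᶠ θ in generic (Stars M) ℝ, (realize M θ).rank = grank M := by
  obtain ⟨⟨θ₀, hθ₀⟩, hmax⟩ := isGreatest_grank M
  filter_upwards [eventually_rank_le (realizeOver M X) θ₀] with θ hθ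
  rw [map_eval_realizeOver_X, map_eval_realizeOver_X] at hθ
  exact (hmax ⟨θ, rfl⟩).antisymm (hθ₀ ▸ hθ)

/-! ### The rank condition and coloops -/

theorem fromRows_mulVec_eq_zero_iff {m₁ m₂ n R : Type*} [Fintype n] [Semiring R]
    {M : Matrix m₁ n R} {N : Matrix m₂ n R} {v : n → R} :
    Matrix.fromRows M N *ᵥ v = 0 ↔ M *ᵥ v = 0 ∧ N *ᵥ v = 0 := by
  rw [Matrix.fromRows_mulVec, ← Sum.elim_zero_zero, Sum.elim_eq_iff]

theorem rank_eq_rank_fromRows_iff {m₁ m₂ n K : Type*} [Finite m₁] [Finite m₂] [Fintype n]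
    [Field K] {M : Matrix m₁ n K} {N : Matrix m₂ n K} :
    M.rank = (Matrix.fromRows M N).rank ↔ ∀ v, M *ᵥ v = 0 → N *ᵥ v = 0 := by
  cases nonempty_fintype m₁
  cases nonempty_fintype m₂
  have hM := M.mulVecLin.finrank_range_add_finrank_ker
  have hMN := (Matrix.fromRows M N).mulVecLin.finrank_range_add_finrank_ker
  have ker_le : (Matrix.fromRows M N).mulVecLin.ker ≤ M.mulVecLin.ker := fun v hv =>
    (fromRows_mulVec_eq_zero_iff.mp hv).1
  calc M.rank = (Matrix.fromRows M N).rank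
      ↔ Module.finrank K (Matrix.fromRows M N).mulVecLin.ker =
          Module.finrank K M.mulVecLin.ker := by
        unfold Matrix.rank
        omega
    _ ↔ (Matrix.fromRows M N).mulVecLin.ker = M.mulVecLin.ker :=
        ⟨Submodule.eq_of_le_of_finrank_eq ker_le, fun h => by rw [h]⟩
    _ ↔ ∀ v, M *ᵥ v = 0 → N *ᵥ v = 0 :=
        ⟨fun h v hv => (fromRows_mulVec_eq_zero_iff.mp (h.ge hv)).2, fun h =>
          ker_le.antisymm fun v hv => fromRows_mulVec_eq_zero_iff.mpr ⟨hv, h v hv⟩⟩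

section Coloops

variable {ι ι₁ ι₂ κ : Type} [Fintype κ]

/-- Column `j` is a coloop of the column matroid of almost every realization of `M`: it lies outside
the span of the other columns, so that every kernel vector vanishes at `j`. -/
def IsGenericColoop (M : SMatrix ι κ) (j : κ) : Prop :=
  ∀ᶠ θ in generic (Stars M) ℝ, ∀ v, realize M θ *ᵥ v = 0 → v j = 0

theorem eventually_realize_mulVec_ne_zero {N : SMatrix ι κ} {i : ι} {j : κ} (hN : N i j = true)
    {v : κ → ℝ} (hv : v j ≠ 0) : ∀ᶠ η in generic (Stars N) ℝ, realize N η *ᵥ v ≠ 0 := by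
  classical
  let f : MvPolynomial (Stars N) ℝ := (realizeOver N X *ᵥ (C ∘ v)) i
  have eval_f (η : Stars N → ℝ) : eval η f = (realize N η *ᵥ v) i := by
    rw [RingHom.map_mulVec, map_eval_realizeOver_X]
    congr! 2
    ext j
    exact eval_C _
  obtain ⟨η₀, hη₀⟩ : ∃ η₀, realize N η₀ = Matrix.single i j 1 :=
    exists_realizeOver_eq fun i' j' h =>
      Matrix.single_apply_of_ne _ _ _ _ _ (by rintro ⟨rfl, rfl⟩; exact h hN)
  have hf : eval η₀ f ≠ 0 := by
    rw [eval_f, hη₀, Matrix.single_mulVec]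
    simpa using hv
  filter_upwards [eventually_eval_ne_zero_of_eval_ne_zero hf] with η hη h0
  exact hη (by rw [eval_f, h0, Pi.zero_apply])

theorem realize_mulVec_eq_zero {N : SMatrix ι κ} {v : κ → ℝ}
    (hv : ∀ j, (∃ i, N i j = true) → v j = 0) (η : Stars N → ℝ) : realize N η *ᵥ v = 0 := by
  ext i
  refine Finset.sum_eq_zero fun j _ => ?_
  by_cases hij : N i j = true
  · rw [hv j ⟨i, hij⟩, mul_zero]
  · simp only [realize, hij, Bool.false_eq_true, ↓reduceDIte, zero_mul]

theorem eventually_forall_realize_mulVec_eq_zero_iff {σ : Type*} {N : SMatrix ι κ}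
    {W : (σ → ℝ) → Set (κ → ℝ)} :
    (∀ᶠ θ in generic (σ ⊕ Stars N) ℝ, ∀ v ∈ W (θ ∘ Sum.inl), realize N (θ ∘ Sum.inr) *ᵥ v = 0) ↔
      ∀ᶠ α in generic σ ℝ, ∀ j, (∃ i, N i j = true) → ∀ v ∈ W α, v j = 0 := by
  constructor
  · intro h
    filter_upwards [eventually_eventually_of_eventually_generic_sum h] with α hα
    rintro j ⟨i, hij⟩ v hv
    by_contra hvj
    obtain ⟨η, hη, hne⟩ := (hα.and (eventually_realize_mulVec_ne_zero hij hvj)).exists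
    exact hne (hη v hv)
  · intro h
    filter_upwards [(tendsto_comp_generic Sum.inl_injective).eventually h] with θ hθ v hv
    exact realize_mulVec_eq_zero (fun j hj => hθ j hj v hv) _

theorem grank_eq_grank_stack_iff [Finite ι₁] [Finite ι₂] {M : SMatrix ι₁ κ} {N : SMatrix ι₂ κ} :
    grank M = grank (stack M N) ↔ ∀ j, (∃ i, N i j = true) → IsGenericColoop M j := by
  have hM : ∀ᶠ θ in generic (Stars M ⊕ Stars N) ℝ, (realize M (θ ∘ Sum.inl)).rank = grank M :=
    (tendsto_comp_generic Sum.inl_injective).eventually (eventually_rank_realize_eq_grank M)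
  have hMN := eventually_realize_stack_iff (Q := fun B => B.rank = grank (stack M N)).mp
    (eventually_rank_realize_eq_grank (stack M N))
  calc grank M = grank (stack M N)
      ↔ ∀ᶠ θ in generic (Stars M ⊕ Stars N) ℝ, ∀ v ∈ {v | realize M (θ ∘ Sum.inl) *ᵥ v = 0},
          realize N (θ ∘ Sum.inr) *ᵥ v = 0 := by
        refine (eventually_const (f := generic (Stars M ⊕ Stars N) ℝ)).symm.trans
          (eventually_congr ?_)
        filter_upwards [hM, hMN] with θ hMθ hMNθ
        rw [← hMθ, ← hMNθ]
        exact rank_eq_rank_fromRows_iff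
    _ ↔ ∀ᶠ θ in generic (Stars M) ℝ, ∀ j, (∃ i, N i j = true) →
          ∀ v, realize M θ *ᵥ v = 0 → v j = 0 := eventually_forall_realize_mulVec_eq_zero_iff
          (W := fun θ => {v | realize M θ *ᵥ v = 0})
    _ ↔ ∀ j, (∃ i, N i j = true) → IsGenericColoop M j := by
        simp only [eventually_all, IsGenericColoop]

theorem grank_eq_grank_stack_unitRow_iff {n : ℕ} [Finite ι] {M : SMatrix ι (Fin n)} {i : Fin n} :
    grank M = grank (stack M (unitRow i)) ↔ IsGenericColoop M i := by
  simp [grank_eq_grank_stack_iff, unitRow]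

end Coloops

/-! ### Coloops and Hall-deficient sets -/

section Hall

variable {ι κ : Type} {M : SMatrix ι κ}

/-- The rows of `M` meeting the columns `S`; for `M = [A; C]` these are the out-neighbours of
`S`. -/
def rowSupport (M : SMatrix ι κ) (S : Set κ) : Set ι :=
  {i | ∃ j ∈ S, M i j = true}

/-- A set of columns of `M` that violates Hall's condition; for `M = [A; C]` this is a dilation. -/
def IsDeficient (M : SMatrix ι κ) (S : Set κ) : Prop :=
  (rowSupport M S).ncard < S.ncard

theorem exists_realize_linearIndepOn_col [Finite ι] [Finite κ] {T : Set κ}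
    (hT : ∀ S ⊆ T, ¬ IsDeficient M S) :
    ∃ θ : Stars M → ℝ, LinearIndepOn ℝ (realize M θ).col T := by
  classical
  cases nonempty_fintype ι
  -- Hall: the columns in `T` are matched with distinct rows; put `1` at the matched positions.
  obtain ⟨f, hf, hfM⟩ := (Finset.all_card_le_biUnion_card_iff_exists_injective
    fun j : T => Finset.univ.filter fun i => M i j = true).mp fun s => by
      have hs := hT ((↑) '' (s : Set T)) (Subtype.coe_image_subset _ _)
      rw [IsDeficient, not_lt, Set.ncard_image_of_injective _ Subtype.val_injective,
        Set.ncard_coe_finset] at hs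
      refine hs.trans_eq ?_
      rw [← Set.ncard_coe_finset]
      congr 1
      ext i
      simp [rowSupport]
  simp only [Finset.mem_filter_univ] at hfM
  obtain ⟨θ, hθ⟩ : ∃ θ : Stars M → ℝ,
      realizeOver M θ = Matrix.of fun i j => if h : j ∈ T then Pi.single (f ⟨j, h⟩) 1 i else 0 :=
    exists_realizeOver_eq fun i j hij => by
      by_cases h : j ∈ T
      · have hne : i ≠ f ⟨j, h⟩ := by rintro rfl; exact hij (hfM ⟨j, h⟩)
        simp [h, Pi.single_eq_of_ne hne]
      · simp [h]
  refine ⟨θ, ?_⟩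
  have hcol : (fun j : T => (realize M θ).col j) = fun j => Pi.single (f j) 1 := by
    ext j i
    exact (congr_fun₂ hθ i j).trans (dif_pos j.2)
  rw [LinearIndepOn, hcol]
  exact (Pi.linearIndependent_single_one ι ℝ).comp f hf

theorem eventually_linearIndepOn_col_of_forall_not_isDeficient [Finite ι] [Finite κ] {T : Set κ}
    (hT : ∀ S ⊆ T, ¬ IsDeficient M S) :
    ∀ᶠ θ in generic (Stars M) ℝ, LinearIndepOn ℝ (realize M θ).col T := by
  obtain ⟨θ₀, h₀⟩ := exists_realize_linearIndepOn_col hT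
  rw [← map_eval_realizeOver_X] at h₀
  simpa only [map_eval_realizeOver_X] using eventually_linearIndepOn_col h₀

theorem not_linearIndepOn_col_of_isDeficient [Finite ι] [Finite κ] {S : Set κ}
    (hS : IsDeficient M S) (θ : Stars M → ℝ) : ¬ LinearIndepOn ℝ (realize M θ).col S := by
  classical
  cases nonempty_fintype ι
  intro h
  have col_eq : (fun j : S => (realize M θ).col j) =
      Function.ExtendByZero.linearMap ℝ ((↑) : rowSupport M S → ι) ∘
        fun (j : S) i => realize M θ i j := by
    ext j i
    by_cases hi : i ∈ rowSupport M S
    · exact (Subtype.val_injective.extend_apply (fun i => realize M θ i j) _ ⟨i, hi⟩).symm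
    · have hij : ¬ M i j = true := fun hij => hi ⟨j, j.2, hij⟩
      rw [Function.comp_apply, Function.ExtendByZero.linearMap_apply,
        Function.extend_apply' _ _ _ (by simpa using hi)]
      exact dif_neg hij
  rw [LinearIndepOn, col_eq] at h
  have := Fintype.ofFinite S
  have := Fintype.ofFinite (rowSupport M S)
  have hcard := (h.of_comp _).fintype_card_le_finrank
  rw [Module.finrank_fintype_fun_eq_card, ← Nat.card_eq_fintype_card,
    ← Nat.card_eq_fintype_card] at hcard
  exact hS.not_ge hcard

variable [Fintype κ]

theorem linearIndepOn_col_iff {R : Type*} [CommRing R] {B : Matrix ι κ R} {T : Set κ} :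
    LinearIndepOn R B.col T ↔ ∀ v, B *ᵥ v = 0 → Function.support v ⊆ T → v = 0 := by
  rw [linearIndepOn_iff, ← (Finsupp.equivFunOnFinite (α := κ) (M := R)).forall_congr_right]
  refine forall_congr' fun l => ?_
  have hB : Finsupp.linearCombination R B.col l = B *ᵥ l := by
    rw [Matrix.mulVec_eq_sum, Finsupp.linearCombination_apply, Finsupp.sum_fintype _ _ (by simp)]
    simp only [op_smul_eq_smul]
    rfl
  have hl : Finsupp.equivFunOnFinite l = l := rfl
  rw [hl, hB, Finsupp.mem_supported, Finsupp.fun_support_eq, Finsupp.coe_eq_zero]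
  exact imp.swap

theorem exists_mulVec_eq_zero_support_ssubset {m n K : Type*} [Fintype n] [Field K]
    {B : Matrix m n K} {v w : n → K} {j : n} (hv : B *ᵥ v = 0) (hw : B *ᵥ w = 0) (hw0 : w ≠ 0)
    (hwv : Function.support w ⊆ Function.support v) (hwj : w j = 0) :
    ∃ u, B *ᵥ u = 0 ∧ u j = v j ∧ Function.support u ⊂ Function.support v := by
  obtain ⟨l, hl⟩ := Function.ne_iff.mp hw0
  refine ⟨v - (v l / w l) • w, ?_, by simp [hwj], ?_⟩
  · rw [Matrix.mulVec_sub, Matrix.mulVec_smul, hv, hw, smul_zero, sub_zero]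
  · refine (Set.ssubset_iff_of_subset ?_).mpr ⟨l, hwv hl, by simp [div_mul_cancel₀ _ hl]⟩
    intro k hk hvk
    have hwk : w k = 0 := Function.notMem_support.mp fun h => hwv h hvk
    exact hk (by simp [hvk, hwk])

theorem isGenericColoop_iff_forall_minimal_isDeficient [Finite ι] {j : κ} :
    IsGenericColoop M j ↔ ∀ S, Minimal (IsDeficient M) S → j ∉ S := by
  constructor
  · intro hj S hS hjS
    have hproper : ∀ S' ⊆ S \ {j}, ¬ IsDeficient M S' := fun S' hS' h =>
      (hS' (hS.le_of_le h (hS'.trans Set.sdiff_subset) hjS)).2 rfl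
    obtain ⟨θ, hθj, hθ⟩ := (hj.and
      (eventually_linearIndepOn_col_of_forall_not_isDeficient hproper)).exists
    refine not_linearIndepOn_col_of_isDeficient hS.prop θ (linearIndepOn_col_iff.mpr ?_)
    intro v hv hvS
    refine linearIndepOn_col_iff.mp hθ v hv fun k hk => ⟨hvS hk, ?_⟩
    rintro rfl
    exact hk (hθj v hv)
  · intro hj
    have hindep : ∀ᶠ θ in generic (Stars M) ℝ, ∀ T : Set κ, (∀ S ⊆ T, ¬ IsDeficient M S) →
        LinearIndepOn ℝ (realize M θ).col T := by
      simp only [eventually_all]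
      exact fun _ => eventually_linearIndepOn_col_of_forall_not_isDeficient
    filter_upwards [hindep] with θ hθ
    by_contra! hker
    -- A kernel vector of minimal support among those not vanishing at `j` can be reduced further:
    -- its support contains a minimal deficient set, which avoids `j` and carries a kernel vector.
    obtain ⟨v, ⟨hv, hvj⟩, hvmin⟩ :=
      exists_minimalFor_of_wellFoundedLT _ Function.support hker
    have hv0 : v ≠ 0 := by rintro rfl; exact hvj rfl
    obtain ⟨S, hSv, hS⟩ : ∃ S ⊆ Function.support v, IsDeficient M S := by
      by_contra! hnone
      exact hv0 (linearIndepOn_col_iff.mp (hθ _ hnone) v hv subset_rfl)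
    obtain ⟨D, hDS, hD⟩ := exists_minimal_le_of_wellFoundedLT _ S hS
    obtain ⟨w, hw, hwD, hw0⟩ : ∃ w, realize M θ *ᵥ w = 0 ∧ Function.support w ⊆ D ∧ w ≠ 0 := by
      simpa only [linearIndepOn_col_iff, not_forall, exists_prop] using
        not_linearIndepOn_col_of_isDeficient hD.prop θ
    obtain ⟨u, hu, huj, huv⟩ := exists_mulVec_eq_zero_support_ssubset hv hw hw0
      (hwD.trans (hDS.trans hSv)) (Function.notMem_support.mp fun h => hj D hD (hwD h))
    exact huv.not_subset (hvmin ⟨hu, huj ▸ hvj⟩ huv.subset)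

theorem isDilation_iff {n p : ℕ} {A : SMatrix (Fin n) (Fin n)} {C : SMatrix (Fin p) (Fin n)}
    {S : Set (Fin n)} : IsDilation A C S ↔ IsDeficient (stack A C) S := by
  have outNeighbors_eq : outNeighbors A C S = rowSupport (stack A C) S := by
    ext (_ | _) <;> rfl
  rw [IsDilation, IsDeficient, outNeighbors_eq]

theorem isMinimalDilation_iff {n p : ℕ} {A : SMatrix (Fin n) (Fin n)}
    {C : SMatrix (Fin p) (Fin n)} {S : Set (Fin n)} :
    IsMinimalDilation A C S ↔ Minimal (IsDeficient (stack A C)) S := by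
  simp only [IsMinimalDilation, minimal_iff_forall_lt, isDilation_iff]

end Hall

/-! ### Common zeros of the pencil determinants -/

section Elimination

open scoped Polynomial nonZeroDivisors

theorem exists_ne_zero_C_mem_of_one_mem_map {R K : Type*} [CommRing R] [IsDomain R] [Field K]
    [Algebra R K] [IsFractionRing R K] {I : Ideal R[X]}
    (h : 1 ∈ I.map (Polynomial.mapRingHom (algebraMap R K))) :
    ∃ d ≠ 0, Polynomial.C d ∈ I := by
  let : Algebra R[X] K[X] := (Polynomial.mapRingHom (algebraMap R K)).toAlgebra
  have : IsLocalization (R⁰.map (Polynomial.C : R →+* R[X])) K[X] := Polynomial.isLocalization R⁰ K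
  obtain ⟨⟨f, s, d, hd, rfl⟩, hfs⟩ := (IsLocalization.mem_map_algebraMap_iff
    (R⁰.map (Polynomial.C : R →+* R[X])) K[X]).mp h
  refine ⟨d, nonZeroDivisors.ne_zero hd, ?_⟩
  rw [one_mul] at hfs
  have hf : Polynomial.C d = (f : R[X]) :=
    Polynomial.map_injective _ (IsFractionRing.injective R K) hfs
  exact hf ▸ f.2

theorem exists_ne_zero_C_mem_of_isUnit_of_dvd {R : Type*} [CommRing R] [IsDomain R]
    [IsGCDMonoid R] {I : Ideal R[X]} (hI : ∀ h, (∀ f ∈ I, h ∣ f) → IsUnit h) :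
    ∃ d ≠ 0, Polynomial.C d ∈ I := by
  let := Classical.arbitrary (NormalizedGCDMonoid R)
  let K := FractionRing R
  obtain ⟨g, hg⟩ := (IsPrincipalIdealRing.principal
    (I.map (Polynomial.mapRingHom (algebraMap R K)))).principal
  have g_dvd (f) (hf : f ∈ I) : g ∣ f.map (algebraMap R K) :=
    Ideal.mem_span_singleton.mp (hg.le (Ideal.mem_map_of_mem _ hf))
  have g_ne_zero : g ≠ 0 := by
    rintro rfl
    refine not_isUnit_zero (hI 0 fun f hf => ?_)
    have := zero_dvd_iff.mp (g_dvd f hf)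
    rw [Polynomial.map_eq_zero_iff (IsFractionRing.injective R K)] at this
    rw [this]
  have g_unit : IsUnit g := by
    let q := IsLocalization.integerNormalization R⁰ g
    obtain ⟨b, hb, hbg⟩ : ∃ b ∈ R⁰, q.map (algebraMap R K) = b • g :=
      IsLocalization.integerNormalization_spec R⁰ g
    have primPart_dvd_g : q.primPart.map (algebraMap R K) ∣ g := by
      have hdvd := Polynomial.map_dvd (algebraMap R K) q.primPart_dvd
      have hb0 : algebraMap R K b ≠ 0 := IsFractionRing.to_map_ne_zero_of_mem_nonZeroDivisors hb
      rwa [hbg, algebra_compatible_smul K, Polynomial.smul_eq_C_mul,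
        (Polynomial.isUnit_C.mpr hb0.isUnit).dvd_mul_left] at hdvd
    refine Polynomial.isUnit_or_eq_zero_of_isUnit_integerNormalization_primPart g_ne_zero
      (hI _ fun f hf => ?_)
    exact q.isPrimitive_primPart.dvd_of_fraction_map_dvd_fraction_map
      (primPart_dvd_g.trans (g_dvd f hf))
  refine exists_ne_zero_C_mem_of_one_mem_map (K := K) ?_
  rw [hg, Ideal.submodule_span_eq, Ideal.span_singleton_eq_top.mpr g_unit]
  trivial

theorem exists_ne_zero_rename_some_mem_of_isUnit_of_dvd {σ k : Type*} [Field k]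
    {I : Ideal (MvPolynomial (Option σ) k)} (hI : ∀ h, (∀ f ∈ I, h ∣ f) → IsUnit h) :
    ∃ d : MvPolynomial σ k, d ≠ 0 ∧ rename some d ∈ I := by
  let e := optionEquivLeft k σ
  have e_rename (d : MvPolynomial σ k) : e (rename some d) = Polynomial.C d := by
    induction d using MvPolynomial.induction_on with
    | C r => simp [e]
    | add p q hp hq => simp only [map_add, hp, hq]
    | mul_X p s hp => simp [e, hp]
  obtain ⟨d, hd, hdI⟩ := exists_ne_zero_C_mem_of_isUnit_of_dvd (I := I.comap e.symm) fun h hh => by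
    rw [← MulEquiv.isUnit_map e.symm]
    refine hI _ fun f hf => ?_
    have := hh (e f) (by simpa using hf)
    simpa using map_dvd e.symm this
  refine ⟨d, hd, ?_⟩
  rwa [Ideal.mem_comap, ← e_rename, AlgEquiv.symm_apply_apply] at hdI

end Elimination

theorem vars_subset_of_dvd {σ R : Type*} [CommRing R] [NoZeroDivisors R] {f g : MvPolynomial σ R}
    (hfg : f ∣ g) (hg : g ≠ 0) : f.vars ⊆ g.vars := by
  obtain ⟨q, rfl⟩ := hfg
  intro s
  rw [mem_vars_iff_degreeOf_ne_zero, mem_vars_iff_degreeOf_ne_zero,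
    degreeOf_mul_eq (left_ne_zero_of_mul hg) (right_ne_zero_of_mul hg)]
  omega

theorem det_mem {ι S T : Type*} [Fintype ι] [DecidableEq ι] [CommRing S] [SetLike T S]
    [SubringClass T S] {U : T} {M : Matrix ι ι S} (hM : ∀ i j, M i j ∈ U) : M.det ∈ U := by
  rw [Matrix.det_apply]
  refine sum_mem fun τ _ => ?_
  rw [Units.smul_def]
  exact zsmul_mem (prod_mem fun i _ => hM _ _) _

theorem notMem_vars_of_dvd_det {σ κ R : Type*} [Fintype κ] [DecidableEq κ] [CommRing R]
    [NoZeroDivisors R] {M : Matrix κ κ (MvPolynomial σ R)} {s : σ} {h : MvPolynomial σ R}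
    (hM : ∀ i j, M i j ∈ supported R ({s}ᶜ : Set σ)) (hdet : M.det ≠ 0)
    (hdvd : h ∣ M.det) : s ∉ h.vars := fun hs =>
  mem_supported.mp (det_mem hM) (vars_subset_of_dvd hdvd hdet hs) rfl

section Pencil

variable {κ R S : Type*} [DecidableEq κ] [CommRing R] [CommRing S]

/-- The matrix pencil `1 - t A`, which is singular exactly at the inverses of the nonzero
eigenvalues of `A`. -/
def pencil (A : Matrix κ κ R) (t : R) : Matrix κ κ R :=
  1 - t • A

theorem mapMatrix_pencil [Fintype κ] (f : R →+* S) (A : Matrix κ κ R) (t : R) :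
    f.mapMatrix (pencil A t) = pencil (f.mapMatrix A) (f t) := by
  ext i j
  simp [pencil, Matrix.one_apply, apply_ite f]

theorem pencil_inv_mulVec_eq_zero {K : Type*} [Field K] [Fintype κ] {A : Matrix κ κ K} {μ : K}
    {u : κ → K} (hμ : μ ≠ 0) (hu : A *ᵥ u = μ • u) : pencil A μ⁻¹ *ᵥ u = 0 := by
  rw [pencil, Matrix.sub_mulVec, Matrix.one_mulVec, Matrix.smul_mulVec, hu, inv_smul_smul₀ hμ,
    sub_self]

theorem updateRow_mulVec_eq_zero {n : Type*} [Fintype n] {B : Matrix κ n R} {u c : n → R} (i : κ)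
    (hB : B *ᵥ u = 0) (hc : c ⬝ᵥ u = 0) : B.updateRow i c *ᵥ u = 0 := by
  ext l
  obtain rfl | hl := eq_or_ne l i
  · simpa [Matrix.mulVec] using hc
  · simpa [Matrix.mulVec, hl] using congrFun hB l

theorem det_pencil_X_updateRow [Fintype κ] (A : Matrix κ κ R) (c : κ → R) (i : κ) :
    ((pencil (A.map PowerSeries.C) PowerSeries.X).updateRow i (PowerSeries.C ∘ c)).det =
      PowerSeries.mk (fun m => (c ᵥ* A ^ m) i) *
        (pencil (A.map PowerSeries.C) PowerSeries.X).det := by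
  -- `G = c (1 - tA)⁻¹` by the Neumann series, so `c` is the combination of the rows of the pencil
  -- with coefficients `G`.
  let N := pencil (A.map PowerSeries.C) PowerSeries.X
  let G (j : κ) : PowerSeries R := PowerSeries.mk fun m => (c ᵥ* A ^ m) j
  have hG : ∑ l, G l • N l = PowerSeries.C ∘ c := by
    ext j m
    have entry : (∑ l, G l • N l) j = G j - PowerSeries.X * ∑ l, G l * PowerSeries.C (A l j) := by
      simp [N, pencil, Matrix.one_apply, mul_sub, Finset.mul_sum, mul_left_comm]
    cases m with
    | zero => simp [entry, G]
    | succ m =>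
      have vecMul_succ : (c ᵥ* A ^ (m + 1)) j = ∑ l, (c ᵥ* A ^ m) l * A l j := by
        rw [pow_succ, ← Matrix.vecMul_vecMul]
        rfl
      simp [entry, PowerSeries.coeff_succ_X_mul, G, vecMul_succ]
  rw [← hG, Matrix.det_updateRow_sum, smul_eq_mul]

theorem det_pencil_X_updateRow_ne_zero [Fintype κ] {A : Matrix κ κ R} {c : κ → R} {i : κ} {m : ℕ}
    (h : (c ᵥ* A ^ m) i ≠ 0) :
    ((pencil (A.map PowerSeries.C) PowerSeries.X).updateRow i (PowerSeries.C ∘ c)).det ≠ 0 := by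
  have det_unit : IsUnit (pencil (A.map PowerSeries.C) PowerSeries.X).det := by
    rw [PowerSeries.isUnit_iff_constantCoeff, RingHom.map_det, mapMatrix_pencil, pencil,
      PowerSeries.constantCoeff_X, zero_smul, sub_zero, Matrix.det_one]
    exact isUnit_one
  rw [det_pencil_X_updateRow, Ne, det_unit.mul_left_eq_zero]
  exact fun h0 => h (by simpa using congrArg (PowerSeries.coeff m) h0)

end Pencil

theorem realizeOver_mem {ι κ : Type} {R T : Type*} [Zero R] [SetLike T R] [ZeroMemClass T R] {U : T}
    {M : SMatrix ι κ} {x : Stars M → R} {i : ι} {j : κ}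
    (hx : ∀ h : M i j = true, x ⟨(i, j), h⟩ ∈ U) : realizeOver M x i j ∈ U := by
  unfold realizeOver
  split_ifs with h
  exacts [hx h, zero_mem U]

section GenericPencil

variable {ι κ : Type} (A : SMatrix κ κ) (C : SMatrix ι κ)

/-- The pencil of the generic realization of `A`, over the polynomial ring in the parameters of
`(A, C)` and one more variable `none`, which stands for the inverse of an eigenvalue. -/
def genericPencil [DecidableEq κ] :
    Matrix κ κ (MvPolynomial (Option (Stars A ⊕ Stars C)) ℝ) :=
  pencil (realizeOver A fun s => X (some (Sum.inl s))) (X none)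

/-- The generic pencil with its row `i` replaced by the generic output row `k`. -/
def genericOutputPencil [DecidableEq κ] (k : ι) (i : κ) :
    Matrix κ κ (MvPolynomial (Option (Stars A ⊕ Stars C)) ℝ) :=
  (genericPencil A C).updateRow i (realizeOver C (fun s => X (some (Sum.inr s))) k)

/-- The ideal of the determinants of the generic pencil and of the generic output pencils. All of
them vanish at `μ⁻¹` when `μ` is a nonzero eigenvalue with an unobservable eigenvector. -/
def pencilIdeal [Fintype κ] [DecidableEq κ] :
    Ideal (MvPolynomial (Option (Stars A ⊕ Stars C)) ℝ) :=
  Ideal.span (insert (genericPencil A C).det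
    (Set.range fun ki : ι × κ => (genericOutputPencil A C ki.1 ki.2).det))

variable {A C}

theorem map_ofReal_realize {M : SMatrix ι κ} (θ : Stars M → ℝ) :
    (realize M θ).map Complex.ofReal = realizeOver M fun s => (θ s : ℂ) :=
  map_realizeOver Complex.ofRealHom M θ

variable [DecidableEq κ]

theorem genericPencil_mem_supported {s : Stars A ⊕ Stars C} {i : κ}
    (hs : ∀ j (h : A i j = true), s ≠ Sum.inl ⟨(i, j), h⟩) (j : κ) :
    genericPencil A C i j ∈ supported ℝ ({some s}ᶜ : Set (Option (Stars A ⊕ Stars C))) := by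
  refine sub_mem ?_ (mul_mem ?_ (realizeOver_mem fun h => ?_))
  · rw [Matrix.one_apply]
    split_ifs
    exacts [one_mem _, zero_mem _]
  · simp
  · simpa using (hs j h).symm

theorem genericOutputPencil_mem_supported (k : ι) (s : Stars A) (i j : κ) :
    genericOutputPencil A C k s.1.1 i j ∈
      supported ℝ ({some (Sum.inl s)}ᶜ : Set (Option (Stars A ⊕ Stars C))) := by
  obtain rfl | hi := eq_or_ne i s.1.1
  · simpa [genericOutputPencil] using realizeOver_mem fun _ => by simp
  · rw [genericOutputPencil, Matrix.updateRow_ne hi]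
    refine genericPencil_mem_supported (fun j' hj' hs => hi ?_) j
    rw [Sum.inl.inj hs]

variable [Fintype κ] {S : Type*} [CommRing S]

theorem mapMatrix_genericPencil
    (f : MvPolynomial (Option (Stars A ⊕ Stars C)) ℝ →+* S) :
    f.mapMatrix (genericPencil A C) =
      pencil (realizeOver A fun s => f (X (some (Sum.inl s)))) (f (X none)) := by
  rw [genericPencil, mapMatrix_pencil, RingHom.mapMatrix_apply, map_realizeOver]
  rfl

theorem mapMatrix_genericOutputPencil
    (f : MvPolynomial (Option (Stars A ⊕ Stars C)) ℝ →+* S) (k : ι) (i : κ) :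
    f.mapMatrix (genericOutputPencil A C k i) =
      (pencil (realizeOver A fun s => f (X (some (Sum.inl s)))) (f (X none))).updateRow i
        (realizeOver C (fun s => f (X (some (Sum.inr s)))) k) := by
  rw [genericOutputPencil, RingHom.mapMatrix_apply, Matrix.map_updateRow, ← RingHom.mapMatrix_apply,
    mapMatrix_genericPencil]
  congr 1
  exact congrFun (map_realizeOver f C _) k

theorem det_genericOutputPencil_ne_zero {k : ι} {i : κ} {m : ℕ} {α : Stars A → ℝ}
    {β : Stars C → ℝ} (h : (realize C β * realize A α ^ m) k i ≠ 0) :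
    (genericOutputPencil A C k i).det ≠ 0 := by
  let f : MvPolynomial (Option (Stars A ⊕ Stars C)) ℝ →+* PowerSeries ℝ :=
    eval₂Hom PowerSeries.C fun s =>
      s.elim PowerSeries.X fun s => PowerSeries.C (Sum.elim α β s)
  have f_det : f (genericOutputPencil A C k i).det =
      ((pencil ((realize A α).map PowerSeries.C) PowerSeries.X).updateRow i
        (PowerSeries.C ∘ realize C β k)).det := by
    rw [RingHom.map_det, mapMatrix_genericOutputPencil,
      show (realize A α).map PowerSeries.C = realizeOver A (PowerSeries.C ∘ α) from
        map_realizeOver PowerSeries.C A α,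
      show PowerSeries.C ∘ realize C β k = realizeOver C (PowerSeries.C ∘ β) k from
        congrFun (map_realizeOver PowerSeries.C C β) k]
    simp only [f, coe_eval₂Hom, eval₂_X, Option.elim_none, Option.elim_some, Sum.elim_inl,
      Sum.elim_inr, Function.comp_def]
  intro h0
  rw [h0, map_zero] at f_det
  exact det_pencil_X_updateRow_ne_zero h f_det.symm

theorem map_det_genericPencil_eq_one (f : MvPolynomial (Option (Stars A ⊕ Stars C)) ℝ →+* S)
    (hf : ∀ s, f (X (some (Sum.inl s))) = 0) : f (genericPencil A C).det = 1 := by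
  have realizeOver_zero : realizeOver A (fun s => f (X (some (Sum.inl s)))) = 0 := by
    ext i j
    simp [realizeOver, hf]
  rw [RingHom.map_det, mapMatrix_genericPencil, realizeOver_zero, pencil, smul_zero, sub_zero,
    Matrix.det_one]

theorem det_genericPencil_ne_zero : (genericPencil A C).det ≠ 0 := fun h0 => by
  simpa [h0] using map_det_genericPencil_eq_one (A := A) (C := C) (eval 0) (by simp)

theorem isUnit_of_forall_mem_pencilIdeal_dvd
    (hA : ∀ s : Stars A, ∃ k, (genericOutputPencil A C k s.1.1).det ≠ 0)
    {h : MvPolynomial (Option (Stars A ⊕ Stars C)) ℝ} (h_dvd : ∀ f ∈ pencilIdeal A C, h ∣ f) :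
    IsUnit h := by
  have h_dvd_det : h ∣ (genericPencil A C).det :=
    h_dvd _ (Ideal.subset_span (Set.mem_insert _ _))
  have vars_h : ∀ s, some s ∉ h.vars := by
    rintro (s | s)
    · obtain ⟨k, hk⟩ := hA s
      exact notMem_vars_of_dvd_det (genericOutputPencil_mem_supported k s) hk
        (h_dvd _ (Ideal.subset_span (Set.mem_insert_of_mem _ ⟨(k, s.1.1), rfl⟩)))
    · exact notMem_vars_of_dvd_det
        (fun i => genericPencil_mem_supported fun _ _ => Sum.inr_ne_inl)
        det_genericPencil_ne_zero h_dvd_det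
  -- `h` involves no parameter, so setting all parameters to zero fixes it and turns `det (1 - tA)`
  -- into `1`.
  let f : MvPolynomial (Option (Stars A ⊕ Stars C)) ℝ →ₐ[ℝ]
      MvPolynomial (Option (Stars A ⊕ Stars C)) ℝ :=
    aeval fun s => s.elim (X none) fun _ => 0
  have f_h : f h = h := by
    refine hom_congr_vars (f₁ := f.toRingHom) (f₂ := RingHom.id _) (by ext; simp) ?_ rfl
    rintro (_ | s) hs _
    exacts [by simp [f], absurd hs (vars_h s)]
  rw [isUnit_iff_dvd_one,
    ← map_det_genericPencil_eq_one (A := A) (C := C) f.toRingHom (by simp [f])]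
  exact f_h ▸ map_dvd f h_dvd_det

theorem pencilIdeal_le_ker {K : Type*} [Field K]
    (f : MvPolynomial (Option (Stars A ⊕ Stars C)) ℝ →+* K) {μ : K} {u : κ → K} (hμ : μ ≠ 0)
    (hu : u ≠ 0) (f_none : f (X none) = μ⁻¹)
    (hAu : realizeOver A (fun s => f (X (some (Sum.inl s)))) *ᵥ u = μ • u)
    (hCu : realizeOver C (fun s => f (X (some (Sum.inr s)))) *ᵥ u = 0) :
    pencilIdeal A C ≤ RingHom.ker f := by
  have hpencil := pencil_inv_mulVec_eq_zero hμ hAu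
  rw [pencilIdeal, Ideal.span_le, Set.insert_subset_iff, Set.range_subset_iff]
  simp only [SetLike.mem_coe, RingHom.mem_ker, RingHom.map_det, mapMatrix_genericPencil,
    mapMatrix_genericOutputPencil, f_none]
  exact ⟨Matrix.exists_mulVec_eq_zero_iff.mp ⟨u, hu, hpencil⟩, fun ki =>
    Matrix.exists_mulVec_eq_zero_iff.mp
      ⟨u, hu, updateRow_mulVec_eq_zero ki.2 hpencil (congrFun hCu ki.1)⟩⟩

theorem eventually_eq_zero_of_mulVec_eq_smul
    (hA : ∀ s : Stars A, ∃ (k : ι) (m : ℕ) (α : Stars A → ℝ) (β : Stars C → ℝ),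
      (realize C β * realize A α ^ m) k s.1.1 ≠ 0) :
    ∀ᶠ θ in generic (Stars A ⊕ Stars C) ℝ, ∀ (μ : ℂ) (u : κ → ℂ), μ ≠ 0 →
      (realize A (θ ∘ Sum.inl)).map Complex.ofReal *ᵥ u = μ • u →
      (realize C (θ ∘ Sum.inr)).map Complex.ofReal *ᵥ u = 0 → u = 0 := by
  obtain ⟨d, hd, hdI⟩ : ∃ d, d ≠ 0 ∧ rename some d ∈ pencilIdeal A C := by
    refine exists_ne_zero_rename_some_mem_of_isUnit_of_dvd fun h h_dvd =>
      isUnit_of_forall_mem_pencilIdeal_dvd (fun s => ?_) h_dvd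
    obtain ⟨k, m, α, β, h⟩ := hA s
    exact ⟨k, det_genericOutputPencil_ne_zero h⟩
  filter_upwards [eventually_eval_ne_zero hd] with θ hθ μ u hμ hAu hCu
  by_contra hu
  let f : MvPolynomial (Option (Stars A ⊕ Stars C)) ℝ →+* ℂ :=
    eval₂Hom Complex.ofRealHom fun s => s.elim μ⁻¹ fun s => (θ s : ℂ)
  have I_le : pencilIdeal A C ≤ RingHom.ker f := by
    rw [map_ofReal_realize] at hAu hCu
    refine pencilIdeal_le_ker f hμ hu (by simp [f]) ?_ ?_ <;> simpa [f]
  have f_d : f (rename some d) = (eval θ d : ℂ) := by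
    rw [coe_eval₂Hom, eval₂_rename]
    exact (eval₂_comp_left Complex.ofRealHom (RingHom.id ℝ) θ d).symm
  exact hθ (by simpa [f_d] using I_le hdI)

end GenericPencil

/-! ### Output-reachable states -/

section OutputReachable

variable {n p : ℕ} {A : SMatrix (Fin n) (Fin n)} {C : SMatrix (Fin p) (Fin n)}

theorem outputReachable_of_output {k : Fin p} {i : Fin n} (h : C k i = true) :
    OutputReachable A C i :=
  ⟨k, .single h⟩

theorem OutputReachable.of_edge {i j : Fin n} (hi : OutputReachable A C i) (h : A i j = true) :
    OutputReachable A C j :=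
  hi.imp fun _ hk => .head (show (systemDigraph A C).Adj (Sum.inl j) (Sum.inl i) from h) hk

@[elab_as_elim]
theorem OutputReachable.induction {P : Fin n → Prop} (output : ∀ k i, C k i = true → P i)
    (edge : ∀ i j, A i j = true → OutputReachable A C i → P i → P j) {i : Fin n}
    (hi : OutputReachable A C i) : P i := by
  obtain ⟨k, hk⟩ := hi
  refine Relation.ReflTransGen.head_induction_on
    (motive := fun v _ => ∀ i, v = Sum.inl i → P i) hk (fun _ h => by cases h) ?_ i rfl
  rintro _ (j | l) hedge hpath ih i rfl
  · exact edge j i hedge ⟨k, hpath⟩ (ih j rfl)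
  · exact output l i hedge

open Classical in
/-- `A` with the rows of the states that are not output-reachable replaced by zero; their columns
then vanish as well. -/
def outputReachablePart (A : SMatrix (Fin n) (Fin n)) (C : SMatrix (Fin p) (Fin n)) :
    SMatrix (Fin n) (Fin n) :=
  fun i j => A i j && decide (OutputReachable A C i)

theorem outputReachablePart_eq_true_iff {i j : Fin n} :
    outputReachablePart A C i j = true ↔ A i j = true ∧ OutputReachable A C i := by
  simp [outputReachablePart]

theorem realize_nonneg {ι κ : Type} {M : SMatrix ι κ} {θ : Stars M → ℝ} (hθ : 0 ≤ θ)
    (i : ι) (j : κ) : 0 ≤ realize M θ i j := by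
  unfold realize
  split_ifs
  exacts [hθ _, le_rfl]

theorem OutputReachable.exists_mul_pow_pos {i : Fin n} (hi : OutputReachable A C i) :
    ∃ (k : Fin p) (m : ℕ),
      0 < (realize C 1 * realize (outputReachablePart A C) 1 ^ m) k i := by
  set A₁ := realize (outputReachablePart A C) 1
  have nonneg (m : ℕ) (k i) : 0 ≤ (realize C 1 * A₁ ^ m) k i := by
    induction m generalizing i with
    | zero => simpa using realize_nonneg zero_le_one k i
    | succ m ih =>
      rw [pow_succ, ← Matrix.mul_assoc, Matrix.mul_apply]
      exact Finset.sum_nonneg fun j _ => mul_nonneg (ih j) (realize_nonneg zero_le_one j i)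
  refine OutputReachable.induction (fun k i h => ⟨k, 0, by simp [realize, h]⟩) ?_ hi
  · rintro i j h hi ⟨k, m, hm⟩
    refine ⟨k, m + 1, ?_⟩
    have edge_eq_one : A₁ i j = 1 := dif_pos (outputReachablePart_eq_true_iff.mpr ⟨h, hi⟩)
    rw [pow_succ, ← Matrix.mul_assoc, Matrix.mul_apply]
    calc 0 < (realize C 1 * A₁ ^ m) k i * A₁ i j := by rwa [edge_eq_one, mul_one]
      _ ≤ _ := Finset.single_le_sum (f := fun l => (realize C 1 * A₁ ^ m) k l * A₁ l j)
        (fun l _ => mul_nonneg (nonneg m k l) (realize_nonneg zero_le_one l j)) (Finset.mem_univ i)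

/-- The parameters of `outputReachablePart A C`, as parameters of `A`. -/
def outputReachableStars (s : Stars (outputReachablePart A C)) : Stars A :=
  ⟨s.1, (outputReachablePart_eq_true_iff.mp s.2).1⟩

theorem outputReachableStars_injective :
    Function.Injective (outputReachableStars : Stars (outputReachablePart A C) → Stars A) :=
  fun _ _ h => Subtype.ext (congrArg (fun s : Stars A => s.1) h)

open Classical in
theorem realize_outputReachablePart_apply (α : Stars A → ℝ) (i j : Fin n) :
    realize (outputReachablePart A C) (α ∘ outputReachableStars) i j =
      if OutputReachable A C i then realize A α i j else 0 := by
  by_cases hi : OutputReachable A C i <;> by_cases h : A i j = true <;>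
    simp [realize, outputReachablePart_eq_true_iff, h, hi, outputReachableStars]

theorem realize_eq_zero_of_outputReachable {α : Stars A → ℝ} {i j : Fin n}
    (hi : OutputReachable A C i) (hj : ¬ OutputReachable A C j) : realize A α i j = 0 :=
  dif_neg fun h => hj (hi.of_edge h)

theorem realize_output_eq_zero {β : Stars C → ℝ} {i : Fin n} (hi : ¬ OutputReachable A C i) (k) :
    realize C β k i = 0 :=
  dif_neg fun h => hi (outputReachable_of_output h)

theorem realize_outputReachablePart_mulVec_indicator (α : Stars A → ℝ) (u : Fin n → ℂ) :
    (realize (outputReachablePart A C) (α ∘ outputReachableStars)).map Complex.ofReal *ᵥ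
        {j | OutputReachable A C j}.indicator u =
      {j | OutputReachable A C j}.indicator ((realize A α).map Complex.ofReal *ᵥ u) := by
  classical
  ext l
  by_cases hl : OutputReachable A C l
  · simp only [Set.indicator, Set.mem_ofPred_eq, hl, ↓reduceIte, Matrix.mulVec, dotProduct,
      Matrix.map_apply, realize_outputReachablePart_apply]
    refine Finset.sum_congr rfl fun j _ => ?_
    by_cases hj : OutputReachable A C j
    · rw [if_pos hj]
    · simp [realize_eq_zero_of_outputReachable hl hj]
  · simp [Set.indicator, hl, Matrix.mulVec, dotProduct, realize_outputReachablePart_apply]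

theorem realize_output_mulVec_indicator (β : Stars C → ℝ) (u : Fin n → ℂ) :
    (realize C β).map Complex.ofReal *ᵥ {j | OutputReachable A C j}.indicator u =
      (realize C β).map Complex.ofReal *ᵥ u := by
  ext k
  simp only [Matrix.mulVec, dotProduct, Matrix.map_apply]
  refine Finset.sum_congr rfl fun j _ => ?_
  by_cases hj : OutputReachable A C j
  · rw [Set.indicator_of_mem (show j ∈ {j | OutputReachable A C j} from hj)]
  · simp [realize_output_eq_zero hj]

theorem eventually_apply_eq_zero_of_mulVec_eq_smul (A : SMatrix (Fin n) (Fin n))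
    (C : SMatrix (Fin p) (Fin n)) :
    ∀ᶠ θ in generic (Stars A ⊕ Stars C) ℝ, ∀ (μ : ℂ) (u : Fin n → ℂ), μ ≠ 0 →
      (realize A (θ ∘ Sum.inl)).map Complex.ofReal *ᵥ u = μ • u →
      (realize C (θ ∘ Sum.inr)).map Complex.ofReal *ᵥ u = 0 →
      ∀ i, OutputReachable A C i → u i = 0 := by
  have hpart := (tendsto_comp_generic
    ((outputReachableStars_injective (A := A) (C := C)).sumMap
      (Function.injective_id (α := Stars C)))).eventually
    (eventually_eq_zero_of_mulVec_eq_smul (A := outputReachablePart A C) (C := C) fun s => by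
      obtain ⟨k, m, h⟩ := (outputReachablePart_eq_true_iff.mp s.2).2.exists_mul_pow_pos
      exact ⟨k, m, 1, 1, h.ne'⟩)
  filter_upwards [hpart] with θ hθ μ u hμ hAu hCu i hi
  suffices {j | OutputReachable A C j}.indicator u = 0 by
    simpa [Set.indicator, hi] using congrFun this i
  refine hθ μ _ hμ ?_ ?_
  · exact (realize_outputReachablePart_mulVec_indicator (θ ∘ Sum.inl) u).trans
      (by rw [hAu]; exact Set.indicator_const_smul _ μ u)
  · exact (realize_output_mulVec_indicator (θ ∘ Sum.inr) u).trans hCu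

end OutputReachable

/-! ### Functional observability and the unobservable subspace -/

section UnobservableSubspace

variable {ι κ R : Type*} [Fintype κ] [DecidableEq κ] [CommRing R]

/-- The unobservable subspace of the pair `(A, C)`: the intersection of the kernels of the blocks
`C A ^ k` of the observability matrix. -/
def unobservableSubspace (A : Matrix κ κ R) (C : Matrix ι κ R) : Submodule R (κ → R) :=
  ⨅ k : ℕ, LinearMap.ker (C * A ^ k).mulVecLin

variable {A : Matrix κ κ R} {C : Matrix ι κ R} {v : κ → R}

theorem mem_unobservableSubspace_iff :
    v ∈ unobservableSubspace A C ↔ ∀ k, C *ᵥ (A ^ k *ᵥ v) = 0 := by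
  simp [unobservableSubspace]

theorem mulVec_mem_unobservableSubspace (hv : v ∈ unobservableSubspace A C) :
    A *ᵥ v ∈ unobservableSubspace A C := by
  rw [mem_unobservableSubspace_iff] at hv ⊢
  intro k
  rw [Matrix.mulVec_mulVec _ (A ^ k) A, ← pow_succ]
  exact hv (k + 1)

theorem mulVec_eq_zero_of_mem_unobservableSubspace (hv : v ∈ unobservableSubspace A C) :
    C *ᵥ v = 0 := by
  simpa using mem_unobservableSubspace_iff.mp hv 0

theorem le_unobservableSubspace {W : Submodule R (κ → R)} (hA : ∀ v ∈ W, A *ᵥ v ∈ W)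
    (hC : ∀ v ∈ W, C *ᵥ v = 0) : W ≤ unobservableSubspace A C := by
  intro v hv
  rw [mem_unobservableSubspace_iff]
  intro k
  refine hC _ ?_
  induction k with
  | zero => simpa
  | succ k ih =>
    rw [pow_succ', ← Matrix.mulVec_mulVec]
    exact hA _ ih

theorem map_comp_mem_unobservableSubspace {S : Type*} [CommRing S] (f : R →+* S)
    (hv : v ∈ unobservableSubspace A C) :
    f ∘ v ∈ unobservableSubspace (A.map f) (C.map f) := by
  rw [mem_unobservableSubspace_iff] at hv ⊢
  intro k
  ext i
  rw [← Matrix.map_pow, Matrix.mulVec_mulVec, ← Matrix.map_mul, ← RingHom.map_mulVec,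
    ← Matrix.mulVec_mulVec, hv k]
  simp

end UnobservableSubspace

section Trajectories

variable {n m p r : ℕ} {A : Matrix (Fin n) (Fin n) ℝ} {B : Matrix (Fin n) (Fin m) ℝ}
  {C : Matrix (Fin p) (Fin n) ℝ} {F : Matrix (Fin r) (Fin n) ℝ} {x₀ : Fin n → ℝ}
  {x : ℝ → Fin n → ℝ}

theorem continuous_mulVec {ι κ : Type*} [Fintype κ] (L : Matrix ι κ ℝ) :
    Continuous fun v => L *ᵥ v :=
  continuous_const.matrix_mulVec continuous_id

theorem IsTrajectory.intervalIntegrable {u : ℝ → Fin m → ℝ} (hu : IsInput u)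
    (hx : IsTrajectory A B u x₀ x) {t : ℝ} (ht : 0 ≤ t) :
    IntervalIntegrable (fun s => A *ᵥ x s + B *ᵥ u s) volume 0 t := by
  refine .add (ContinuousOn.intervalIntegrable ?_) ?_
  · rw [Set.uIcc_of_le ht]
    exact (continuous_mulVec A).comp_continuousOn (hx.1.mono Set.Icc_subset_Ici_self)
  · let b := B.mulVecLin.toContinuousLinearMap
    exact ⟨b.integrable_comp (hu t ht).1, b.integrable_comp (hu t ht).2⟩

theorem IsTrajectory.sub {u u' : ℝ → Fin m → ℝ} {x₁ : Fin n → ℝ} {x' : ℝ → Fin n → ℝ}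
    (hu : IsInput u) (hu' : IsInput u') (hx : IsTrajectory A B u x₀ x)
    (hx' : IsTrajectory A B u' x₁ x') :
    IsTrajectory A B (u - u') (x₀ - x₁) (x - x') := by
  refine ⟨hx.1.sub hx'.1, fun t ht => ?_⟩
  simp only [Pi.sub_apply, Matrix.mulVec_sub, sub_add_sub_comm]
  rw [intervalIntegral.integral_sub (hx.intervalIntegrable hu ht)
    (hx'.intervalIntegrable hu' ht), hx.2 t ht, hx'.2 t ht, add_sub_add_comm]

theorem IsTrajectory.apply_zero {u : ℝ → Fin m → ℝ} (hx : IsTrajectory A B u x₀ x) :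
    x 0 = x₀ := by
  simpa using hx.2 0 le_rfl

theorem IsTrajectory.hasDerivAt (hx : IsTrajectory A B 0 x₀ x) {t : ℝ} (ht : 0 < t) :
    HasDerivAt x (A *ᵥ x t) t := by
  have hcont : ContinuousOn (fun s => A *ᵥ x s) (Set.Ici 0) :=
    (continuous_mulVec A).comp_continuousOn hx.1
  have hint : IntervalIntegrable (fun s => A *ᵥ x s) volume 0 t :=
    (hcont.mono (by rw [Set.uIcc_of_le ht.le]; exact Set.Icc_subset_Ici_self)).intervalIntegrable
  have hderiv : HasDerivAt (fun t => ∫ s in (0 : ℝ)..t, A *ᵥ x s) (A *ᵥ x t) t :=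
    intervalIntegral.integral_hasDerivAt_right hint
      ((hcont.mono Set.Ioi_subset_Ici_self).stronglyMeasurableAtFilter isOpen_Ioi t ht)
      (hcont.continuousAt (Ici_mem_nhds ht))
  refine (hderiv.const_add x₀).congr_of_eventuallyEq ?_
  filter_upwards [Ioi_mem_nhds ht] with s hs
  simpa using hx.2 s (le_of_lt hs)

theorem isTrajectory_of_hasDerivAt (hx : ∀ t, HasDerivAt x (A *ᵥ x t) t) :
    IsTrajectory A B 0 (x 0) x := by
  have hcont : Continuous x := continuous_iff_continuousAt.mpr fun t => (hx t).continuousAt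
  refine ⟨hcont.continuousOn, fun t _ => ?_⟩
  simp only [Pi.zero_apply, Matrix.mulVec_zero, add_zero]
  rw [intervalIntegral.integral_eq_sub_of_hasDerivAt (fun s _ => hx s)
    (((continuous_mulVec A).comp hcont).intervalIntegrable 0 t), add_sub_cancel]

theorem eqOn_zero_of_hasDerivAt {E : Type*} [NormedAddCommGroup E] [NormedSpace ℝ E] {f g : ℝ → E}
    {a b : ℝ} (hab : a ≠ b) (hf : Set.EqOn f 0 (Set.Icc a b)) (hg : ContinuousOn g (Set.Icc a b))
    (hderiv : ∀ t ∈ Set.Ioo a b, HasDerivAt f (g t) t) : Set.EqOn g 0 (Set.Icc a b) := by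
  have hIoo : Set.EqOn g 0 (Set.Ioo a b) := fun t ht =>
    (hderiv t ht).unique ((hasDerivAt_const t 0).congr_of_eventuallyEq
      (hf.eventuallyEq_of_mem (Icc_mem_nhds ht.1 ht.2)))
  exact hIoo.of_subset_closure hg continuousOn_const Set.Ioo_subset_Icc_self (closure_Ioo hab).ge

theorem exp_apply_mem {E : Type*} [NormedAddCommGroup E] [NormedSpace ℝ E] [CompleteSpace E]
    {W : Submodule ℝ E} (hW : IsClosed (W : Set E)) {a : E →L[ℝ] E} (ha : ∀ v ∈ W, a v ∈ W)
    {v : E} (hv : v ∈ W) : NormedSpace.exp a v ∈ W := by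
  have hasSum_exp := (NormedSpace.exp_series_hasSum_exp' (𝕂 := ℝ) a).mapL
    (ContinuousLinearMap.apply ℝ E v)
  refine hW.mem_of_tendsto hasSum_exp (.of_forall fun s => W.sum_mem fun k hk => W.smul_mem _ ?_)
  clear hk
  induction k with
  | zero => simpa
  | succ k ih => exact pow_succ' a k ▸ ha _ ih

theorem exists_isTrajectory_of_mem_unobservableSubspace {v : Fin n → ℝ}
    (hv : v ∈ unobservableSubspace A C) :
    ∃ x, IsTrajectory A B 0 v x ∧ ∀ t, C *ᵥ x t = 0 := by
  let a : (Fin n → ℝ) →L[ℝ] (Fin n → ℝ) := A.mulVecLin.toContinuousLinearMap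
  refine ⟨fun t => NormedSpace.exp (t • a) v, ?_, fun t => ?_⟩
  · have hderiv (t : ℝ) :=
      (hasDerivAt_exp_smul_const' (𝕂 := ℝ) a t).clm_apply (hasDerivAt_const t v)
    simpa using isTrajectory_of_hasDerivAt (A := A) (B := B)
      (x := fun t => NormedSpace.exp (t • a) v) fun t => by simpa [a] using hderiv t
  · refine mulVec_eq_zero_of_mem_unobservableSubspace (exp_apply_mem
      (Submodule.closed_of_finiteDimensional _) (fun w hw => ?_) hv)
    exact Submodule.smul_mem _ t (mulVec_mem_unobservableSubspace hw)

theorem IsTrajectory.mem_unobservableSubspace {T : ℝ} (hx : IsTrajectory A B 0 x₀ x)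
    (hT : 0 < T) (hy : ∀ t ∈ Set.Icc 0 T, C *ᵥ x t = 0) : x₀ ∈ unobservableSubspace A C := by
  have output_zero (k : ℕ) : Set.EqOn (fun t => C *ᵥ (A ^ k *ᵥ x t)) 0 (Set.Icc 0 T) := by
    induction k with
    | zero => simpa [Set.EqOn] using hy
    | succ k ih =>
      refine eqOn_zero_of_hasDerivAt hT.ne ih ?_ fun t ht => ?_
      · exact ((continuous_mulVec C).comp (continuous_mulVec (A ^ (k + 1)))).comp_continuousOn
          (hx.1.mono Set.Icc_subset_Ici_self)
      · let l := (C * A ^ k).mulVecLin.toContinuousLinearMap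
        simpa [l, pow_succ, Function.comp_def] using
          l.hasFDerivAt.comp_hasDerivAt t (hx.hasDerivAt ht.1)
  rw [mem_unobservableSubspace_iff, ← hx.apply_zero]
  exact fun k => output_zero k ⟨le_rfl, hT.le⟩

theorem functionallyObservable_iff :
    FunctionallyObservable A C F ↔ ∀ v ∈ unobservableSubspace A C, F *ᵥ v = 0 := by
  constructor
  · intro h v hv
    obtain ⟨x, hx, hy⟩ := exists_isTrajectory_of_mem_unobservableSubspace (B := 0) hv
    obtain ⟨T, -, hT⟩ := h 0 0 0 0 fun t _ => intervalIntegrable_const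
    have zero_trajectory : IsTrajectory A (0 : Matrix (Fin n) (Fin 0) ℝ) 0 0 0 :=
      ⟨continuousOn_const, fun t _ => by simp⟩
    simpa using (hT v 0 x zero_trajectory hx fun t _ => by simp [hy t]).symm
  · intro h m B x₀ u hu
    refine ⟨1, one_pos, fun x₁ x x' hx hx' hy => ?_⟩
    have hsub := hx.sub hu hu hx'
    rw [sub_self] at hsub
    rw [← sub_eq_zero, ← Matrix.mulVec_sub]
    exact h _ (hsub.mem_unobservableSubspace one_pos fun t ht => by
      rw [Pi.sub_apply, Matrix.mulVec_sub, hy t ht, sub_self])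

end Trajectories

theorem le_of_inf_eigenspace_le {K V : Type*} [Field K] [AddCommGroup V] [Module K V]
    [FiniteDimensional K V] {f : Module.End K V} {W U : Submodule K V}
    (hf : ⨆ μ, f.eigenspace μ = ⊤) (hW : ∀ v ∈ W, f v ∈ W)
    (h : ∀ μ, W ⊓ f.eigenspace μ ≤ U) : W ≤ U := by
  have hdecomp := Submodule.inf_iSup_genEigenspace hW 1
  rw [show ⨆ μ, f.genEigenspace μ 1 = ⊤ from hf, inf_top_eq] at hdecomp
  exact hdecomp.trans_le (iSup_le h)

theorem IsDiagonalizable.iSup_eigenspace_eq_top {n : ℕ} {A : Matrix (Fin n) (Fin n) ℝ}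
    (hA : IsDiagonalizable A) :
    ⨆ μ, Module.End.eigenspace (A.map Complex.ofReal).mulVecLin μ = ⊤ := by
  obtain ⟨P, d, hP, hPd⟩ := hA
  have range_eq_top : LinearMap.range P.mulVecLin = ⊤ :=
    LinearMap.range_eq_top.mpr (Matrix.mulVec_surjective_iff_isUnit.mpr hP)
  rw [eq_top_iff, ← range_eq_top, Matrix.range_mulVecLin, Submodule.span_le,
    Set.range_subset_iff]
  refine fun j => Submodule.mem_iSup_of_mem (d j) ?_
  rw [Module.End.mem_eigenspace_iff, Matrix.mulVecLin_apply]
  ext i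
  have hcol := congrFun (congrFun hPd i) j
  rw [Matrix.mul_diagonal] at hcol
  exact hcol.trans (mul_comm _ _)

theorem re_mulVec {ι κ : Type*} [Fintype κ] (B : Matrix ι κ ℝ) (u : κ → ℂ) :
    Complex.re ∘ (B.map Complex.ofReal *ᵥ u) = B *ᵥ (Complex.re ∘ u) := by
  ext i
  simp [Matrix.mulVec, dotProduct]

theorem im_mulVec {ι κ : Type*} [Fintype κ] (B : Matrix ι κ ℝ) (u : κ → ℂ) :
    Complex.im ∘ (B.map Complex.ofReal *ᵥ u) = B *ᵥ (Complex.im ∘ u) := by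
  ext i
  simp [Matrix.mulVec, dotProduct]

theorem apply_eq_zero_of_mem_unobservableSubspace {n p : ℕ} {A : Matrix (Fin n) (Fin n) ℝ}
    {C : Matrix (Fin p) (Fin n) ℝ} (hA : IsDiagonalizable A) {i : Fin n}
    (hzero : ∀ v, A *ᵥ v = 0 → C *ᵥ v = 0 → v i = 0)
    (hne : ∀ (μ : ℂ) (u : Fin n → ℂ), μ ≠ 0 → A.map Complex.ofReal *ᵥ u = μ • u →
      C.map Complex.ofReal *ᵥ u = 0 → u i = 0)
    {v : Fin n → ℝ} (hv : v ∈ unobservableSubspace A C) : v i = 0 := by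
  suffices unobservableSubspace (A.map Complex.ofReal) (C.map Complex.ofReal) ≤
      LinearMap.ker (LinearMap.proj i : (Fin n → ℂ) →ₗ[ℂ] ℂ) by
    simpa using this (map_comp_mem_unobservableSubspace Complex.ofRealHom hv)
  refine le_of_inf_eigenspace_le hA.iSup_eigenspace_eq_top
    (fun _ => mulVec_mem_unobservableSubspace) fun μ u hu => ?_
  have hAu : A.map Complex.ofReal *ᵥ u = μ • u := Module.End.mem_eigenspace_iff.mp hu.2
  have hCu := mulVec_eq_zero_of_mem_unobservableSubspace hu.1
  rw [LinearMap.mem_ker, LinearMap.proj_apply]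
  obtain rfl | hμ := eq_or_ne μ 0
  · rw [zero_smul] at hAu
    refine Complex.ext (hzero (Complex.re ∘ u) ?_ ?_) (hzero (Complex.im ∘ u) ?_ ?_) <;>
      first | rw [← re_mulVec] | rw [← im_mulVec]
    all_goals simp only [hAu, hCu]; rfl
  · exact hne μ u hμ hAu hCu

/-! ### Structural functional observability -/

section StructuralFunctionalObservability

variable {n p r : ℕ} {A : SMatrix (Fin n) (Fin n)} {C : SMatrix (Fin p) (Fin n)}
  {F : SMatrix (Fin r) (Fin n)}

theorem sfo_iff :
    SFO A C F ↔ ∀ᶠ θ in generic (Stars A ⊕ Stars C) ℝ, ∀ i ∈ functionalStates F,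
      ∀ v ∈ unobservableSubspace (realize A (θ ∘ Sum.inl)) (realize C (θ ∘ Sum.inr)), v i = 0 := by
  let N (θ : Stars A ⊕ Stars C → ℝ) :=
    unobservableSubspace (realize A (θ ∘ Sum.inl)) (realize C (θ ∘ Sum.inr))
  calc SFO A C F
      ↔ ∀ᶠ θ in generic (Stars A ⊕ Stars C ⊕ Stars F) ℝ,
          (∀ v ∈ N ((θ ∘ Equiv.sumAssoc _ _ _) ∘ Sum.inl),
            realize F ((θ ∘ Equiv.sumAssoc _ _ _) ∘ Sum.inr) *ᵥ v = 0) := by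
        simp_rw [SFO, functionallyObservable_iff]
        exact exists_isProperVariety_iff
    _ ↔ ∀ᶠ θ in generic ((Stars A ⊕ Stars C) ⊕ Stars F) ℝ,
          (∀ v ∈ N (θ ∘ Sum.inl), realize F (θ ∘ Sum.inr) *ᵥ v = 0) :=
        eventually_generic_comp_equiv_iff (Equiv.sumAssoc _ _ _)
          (Q := fun θ => ∀ v ∈ N (θ ∘ Sum.inl), realize F (θ ∘ Sum.inr) *ᵥ v = 0)
    _ ↔ _ := eventually_forall_realize_mulVec_eq_zero_iff (N := F)
          (W := fun θ => (N θ : Set (Fin n → ℝ)))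

theorem isGenericColoop_stack_iff {i : Fin n} :
    IsGenericColoop (stack A C) i ↔ ∀ᶠ θ in generic (Stars A ⊕ Stars C) ℝ,
      ∀ v, realize A (θ ∘ Sum.inl) *ᵥ v = 0 → realize C (θ ∘ Sum.inr) *ᵥ v = 0 → v i = 0 := by
  simp only [IsGenericColoop,
    eventually_realize_stack_iff (Q := fun B => ∀ v, B *ᵥ v = 0 → v i = 0),
    fromRows_mulVec_eq_zero_iff, and_imp]

theorem single_mem_unobservableSubspace {i : Fin n} (hi : ¬ OutputReachable A C i)
    (α : Stars A → ℝ) (β : Stars C → ℝ) :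
    Pi.single i 1 ∈ unobservableSubspace (realize A α) (realize C β) := by
  let W : Submodule ℝ (Fin n → ℝ) := ⨅ j : {j // OutputReachable A C j},
    LinearMap.ker (LinearMap.proj j.1)
  have mem_W {v} : v ∈ W ↔ ∀ j, OutputReachable A C j → v j = 0 := by simp [W]
  refine le_unobservableSubspace (W := W) (fun v hv => mem_W.mpr fun l hl => ?_) (fun v hv => ?_)
    (mem_W.mpr fun j hj => Pi.single_eq_of_ne (by rintro rfl; exact hi hj) 1)
  · rw [Matrix.mulVec, dotProduct]
    refine Finset.sum_eq_zero fun j _ => ?_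
    by_cases hj : OutputReachable A C j
    · rw [mem_W.mp hv j hj, mul_zero]
    · rw [realize_eq_zero_of_outputReachable hl hj, zero_mul]
  · exact realize_mulVec_eq_zero (fun j ⟨_, h⟩ => mem_W.mp hv j (outputReachable_of_output h)) β

theorem SFO.outputReachable (h : SFO A C F) {i : Fin n} (hi : i ∈ functionalStates F) :
    OutputReachable A C i := by
  by_contra hreach
  obtain ⟨θ, hθ⟩ := (sfo_iff.mp h).exists
  simpa using hθ i hi _ (single_mem_unobservableSubspace hreach _ _)

theorem SFO.isGenericColoop (h : SFO A C F) {i : Fin n} (hi : i ∈ functionalStates F) :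
    IsGenericColoop (stack A C) i := by
  rw [isGenericColoop_stack_iff]
  filter_upwards [sfo_iff.mp h] with θ hθ v hAv hCv
  refine hθ i hi v (le_unobservableSubspace (W := Submodule.span ℝ {v}) ?_ ?_
    (Submodule.mem_span_singleton_self v)) <;>
    simp [Submodule.mem_span_singleton, Matrix.mulVec_smul, hAv, hCv]

theorem sfo_of_outputReachable_of_isGenericColoop (hA : GenericallyDiagonalizable A)
    (hreach : ∀ i ∈ functionalStates F, OutputReachable A C i)
    (hcoloop : ∀ i ∈ functionalStates F, IsGenericColoop (stack A C) i) : SFO A C F := by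
  have hdiag : ∀ᶠ θ in generic (Stars A ⊕ Stars C) ℝ, IsDiagonalizable (realize A (θ ∘ Sum.inl)) :=
    (tendsto_comp_generic Sum.inl_injective).eventually (exists_isProperVariety_iff.mp hA)
  have hker : ∀ᶠ θ in generic (Stars A ⊕ Stars C) ℝ, ∀ i ∈ functionalStates F,
      ∀ v, realize A (θ ∘ Sum.inl) *ᵥ v = 0 → realize C (θ ∘ Sum.inr) *ᵥ v = 0 → v i = 0 := by
    simpa only [eventually_all_finite (functionalStates F).toFinite, isGenericColoop_stack_iff]
      using hcoloop
  rw [sfo_iff]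
  filter_upwards [hdiag, hker, eventually_apply_eq_zero_of_mulVec_eq_smul A C]
    with θ hθA hθ_ker hθ_modes i hi v hv
  exact apply_eq_zero_of_mem_unobservableSubspace hθA (hθ_ker i hi)
    (fun μ u hμ hAu hCu => hθ_modes μ u hμ hAu hCu i (hreach i hi)) hv

theorem isGenericColoop_stack_iff_notMem_minimalDilation {i : Fin n} :
    IsGenericColoop (stack A C) i ↔ ¬ ∃ S, IsMinimalDilation A C S ∧ i ∈ S := by
  simp only [isGenericColoop_iff_forall_minimal_isDeficient, isMinimalDilation_iff, not_exists,
    not_and]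

end StructuralFunctionalObservability

end StructSys

end

theorem mainTheorem2 {n p r : ℕ} (A : StructSys.SMatrix (Fin n) (Fin n))
    (C : StructSys.SMatrix (Fin p) (Fin n)) (F : StructSys.SMatrix (Fin r) (Fin n))
    (hA : StructSys.GenericallyDiagonalizable A) :
    List.TFAE [
      StructSys.SFO A C F,
      (∀ i ∈ StructSys.functionalStates F, StructSys.OutputReachable A C i) ∧
        StructSys.grank (StructSys.stack A C) =
          StructSys.grank (StructSys.stack (StructSys.stack A C) F),
      (∀ i ∈ StructSys.functionalStates F, StructSys.OutputReachable A C i) ∧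
        ∀ i ∈ StructSys.functionalStates F,
          StructSys.grank (StructSys.stack A C) =
            StructSys.grank (StructSys.stack (StructSys.stack A C) (StructSys.unitRow i)),
      (∀ i ∈ StructSys.functionalStates F, StructSys.OutputReachable A C i) ∧
        ∀ i ∈ StructSys.functionalStates F,
          ¬ ∃ S : Set (Fin n), StructSys.IsMinimalDilation A C S ∧ i ∈ S] := by
  have rank_condition_iff : StructSys.grank (StructSys.stack A C) =
      StructSys.grank (StructSys.stack (StructSys.stack A C) F) ↔
        ∀ i ∈ StructSys.functionalStates F, StructSys.IsGenericColoop (StructSys.stack A C) i :=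
    StructSys.grank_eq_grank_stack_iff
  simp only [rank_condition_iff, StructSys.grank_eq_grank_stack_unitRow_iff,
    ← StructSys.isGenericColoop_stack_iff_notMem_minimalDilation]
  tfae_have 1 → 2 := fun h => ⟨fun _ hi => h.outputReachable hi, fun _ hi => h.isGenericColoop hi⟩
  tfae_have 2 → 1 := fun h => StructSys.sfo_of_outputReachable_of_isGenericColoop hA h.1 h.2
  tfae_have 2 ↔ 3 := Iff.rfl
  tfae_have 3 ↔ 4 := Iff.rfl
  tfae_finish
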